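/- Let $(\lambda_x)_{x\in\mathbb N}$ and $(\nu_x)_{x\in\mathbb N}$ be real rates on $\mathbb N=\{0,1,2,\dots\}$ with $\lambda_x>0$ for all $x\ge 0$, $\nu_x>0$ for all $x\ge 1$ and $\nu_0=0$. Put $\mu(0)=1$, $\mu(x)=\frac{\lambda_0\cdots\lambda_{x-1}}{\nu_1\cdots\nu_x}$ for $x\ge1$, and assume $$\sum_{x\ge 0}\mu(x)\sum_{y\ge x}\frac1{\mu(y)\lambda_y}=+\infty,\qquad \sum_{x\ge0}\mu(x)<+\infty .$$ Let $\{(X_t)_{t\ge0},(\mathbb P_x)_{x\in\mathbb N}\}$ be the corresponding birth–death process, that is, a càdlàg Markov process on $\mathbb N$ whose transition probabilities $P_t(x,\cdot)=\mathbb P_x(X_t\in\cdot)$ satisfy, for all $x\in\mathbb N$ and $A\subseteq\mathbb N$, $$\lim_{t\downarrow0}\frac{P_t(x,A)-1_A(x)}{t}=\mathcal L1_A(x),\qquad \mathcal Lf(x)=\lambda_x(f(x+1)-f(x))+\nu_x(f(x-1)-f(x)).$$ Let $u:\mathbb N\to(0,\infty)$, set $u_{-1}:=1$, and let $\delta(x,y)=\bigl|\sum_{k<x}u_k-\sum_{k<y}u_k\bigr|$.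 Assume that, for all $t>0$ and $x\in\mathbb N$, the measure $P_t(x,\cdot)$ integrates $\delta(z,\cdot)$ for some (equivalently, all) $z\in\mathbb N$. For $f:\mathbb N\to\mathbb R$ let $\|f\|_{\mathrm{Lip}_\delta}=\sup_{x\ne y}|f(x)-f(y)|/\delta(x,y)\in[0,\infty]$ and $P_tf(x)=\sum_y f(y)P_t(x,\{y\})$, and define, with values in $[-\infty,\infty]$, $$\bar\sigma_\delta(t)=-\sup\{\log\|P_tf\|_{\mathrm{Lip}_\delta}:\|f\|_{\mathrm{Lip}_\delta}=1\},\qquad \sigma_\delta=\inf_{t>0}\frac{\bar\sigma_\delta(t)}t .$$ Then the Wasserstein curvature $\sigma_\delta$ with respect to $\delta$ is also the limit $\lim_{t\downarrow0}\bar\sigma_\delta(t)/t$, and, as an identity in $[-\infty,\infty)$, $$\sigma_\delta=\inf_{x\in\mathbb N}\Bigl\{\nu_{x+1}+\lambda_x-\nu_x\frac{u_{x-1}}{u_x}-\lambda_{x+1}\frac{u_{x+1}}{u_x}\Bigr\}.$$ In particular, one side is $-\infty$ if and only if the other is. -/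

import Mathlib

open MeasureTheory Filter Topology
open scoped NNReal ENNReal

noncomputable section

namespace BirthDeath

section Markov

variable {S Ω : Type*} [MeasurableSpace S] [mΩ : MeasurableSpace Ω]

/-- The transition probability `P_t(x, dy) = Pr_x (X_t ∈ dy)`. -/
def transition (Pr : S → Measure Ω) (X : ℝ≥0 → Ω → S) (t : ℝ≥0) (x : S) : Measure S :=
  (Pr x).map (X t)

/-- The semigroup `P_t f(x) = ∫ f(y) P_t(x, dy)`. -/
def semigroup (Pr : S → Measure Ω) (X : ℝ≥0 → Ω → S) (t : ℝ≥0) (f : S → ℝ) (x : S) : ℝ :=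
  ∫ y, f y ∂(transition Pr X t x)

/-- A (time-homogeneous) càdlàg Markov process `(X_t)` on the filtered space `(Ω, ℱ)`, under the
family of laws `(Pr_x)`, where `Pr_x` is the law started from `x`. -/
structure IsMarkovProcess [TopologicalSpace S] (ℱ : Filtration ℝ≥0 mΩ)
    (Pr : S → Measure Ω) (X : ℝ≥0 → Ω → S) : Prop where
  isProbabilityMeasure : ∀ x, IsProbabilityMeasure (Pr x)
  adapted : ∀ t, Measurable[ℱ t] (X t)
  rightContinuous : ∀ ω t, ContinuousWithinAt (fun s => X s ω) (Set.Ici t) t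
  leftLimits : ∀ ω t, ∃ l : S, Tendsto (fun s => X s ω) (𝓝[<] t) (𝓝 l)
  start : ∀ x, ∀ᵐ ω ∂(Pr x), X 0 ω = x
  markov : ∀ (x : S) (s t : ℝ≥0) (A : Set S), MeasurableSet A →
    (Pr x)[(X (s + t) ⁻¹' A).indicator (fun _ => (1 : ℝ)) | ℱ s]
      =ᵐ[Pr x] fun ω => (transition Pr X t (X s ω)).real A

end Markov

section Curvature

variable {S : Type*}

/-- The Lipschitz seminorm `sup_{x ≠ y} |f(x) - f(y)| / d(x, y)`, possibly infinite. -/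
def lipSeminorm (d : S → S → ℝ) (f : S → ℝ) : ℝ≥0∞ :=
  ⨆ (x : S) (y : S) (_ : x ≠ y), ENNReal.ofReal (|f x - f y| / d x y)

/-- The measure `μ` integrates `d(x, ·)` for some point `x`. -/
def HasFiniteMoment [MeasurableSpace S] (d : S → S → ℝ) (μ : Measure S) : Prop :=
  ∃ x, Integrable (fun y => d x y) μ

/-- `σ̄_d(t) = - sup {log ‖P_t f‖_Lip : ‖f‖_Lip = 1}`, an extended real number. Here `P` is the
semigroup, and `log 0 = -∞`, `log ∞ = ∞`. -/
def curvatureProfile (d : S → S → ℝ) (P : ℝ≥0 → (S → ℝ) → S → ℝ) (t : ℝ≥0) : EReal :=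
  -⨆ (f : S → ℝ) (_ : lipSeminorm d f = 1), ENNReal.log (lipSeminorm d (P t f))

/-- The Wasserstein curvature `σ_d = inf_{t > 0} σ̄_d(t) / t`. -/
def wassersteinCurvature (d : S → S → ℝ) (P : ℝ≥0 → (S → ℝ) → S → ℝ) : EReal :=
  ⨅ (t : ℝ≥0) (_ : 0 < t), curvatureProfile d P t / ((t : ℝ) : EReal)

end Curvature

/-- The birth–death generator
`ℒ f(x) = λ_x (f(x + 1) - f(x)) + ν_x (f(x - 1) - f(x))`. The truncated value of `x - 1` at `x = 0`
is harmless since `ν_0 = 0` wherever this is used. -/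
def generator (lam nu : ℕ → ℝ) (f : ℕ → ℝ) (x : ℕ) : ℝ :=
  lam x * (f (x + 1) - f x) + nu x * (f (x - 1) - f x)

/-- The reversible measure `μ(x) = (λ_0 ⋯ λ_{x-1}) / (ν_1 ⋯ ν_x)`, with `μ(0) = 1`. -/
def revMeasure (lam nu : ℕ → ℝ) (x : ℕ) : ℝ :=
  ∏ k ∈ Finset.range x, lam k / nu (k + 1)

/-- Transition rates of an ergodic birth–death process on `ℕ`. -/
structure IsErgodicRates (lam nu : ℕ → ℝ) : Prop where
  birth_pos : ∀ x, 0 < lam x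
  death_zero : nu 0 = 0
  death_pos : ∀ x, 0 < nu (x + 1)
  divergence : ∑' x : ℕ, ENNReal.ofReal (revMeasure lam nu x) *
    (∑' y : Set.Ici x, ENNReal.ofReal (1 / (revMeasure lam nu y * lam y))) = ∞
  summable : Summable (revMeasure lam nu)

/-- A birth–death process with rates `lam`, `nu`: a càdlàg Markov process on `ℕ` whose transition
probabilities satisfy `(P_t(x, A) - 1_A(x)) / t → ℒ 1_A(x)` as `t ↓ 0`, for every `A` and `x`. -/
structure IsBirthDeathProcess {Ω : Type*} [mΩ : MeasurableSpace Ω] (lam nu : ℕ → ℝ)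
    (ℱ : Filtration ℝ≥0 mΩ) (Pr : ℕ → Measure Ω) (X : ℝ≥0 → Ω → ℕ) : Prop
    extends IsMarkovProcess ℱ Pr X where
  rates : ∀ (x : ℕ) (A : Set ℕ),
    Tendsto (fun t : ℝ≥0 =>
        ((transition Pr X t x).real A - A.indicator (fun _ => (1 : ℝ)) x) / (t : ℝ))
      (𝓝[>] 0) (𝓝 (generator lam nu (A.indicator (fun _ => (1 : ℝ))) x))

/-- The metric `δ(x, y) = |∑_{k < x} u_k - ∑_{k < y} u_k|`. -/
def weightDist (u : ℕ → ℝ) (x y : ℕ) : ℝ :=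
  |∑ k ∈ Finset.range x, u k - ∑ k ∈ Finset.range y, u k|

/-- The shifted weight `u_{x-1}`, with `u_{-1} = 1`. -/
def prevWeight (u : ℕ → ℝ) : ℕ → ℝ
  | 0 => 1
  | x + 1 => u x

end BirthDeath

end

noncomputable section

namespace BirthDeath

/-! Write U for `cumWeight u`, so that δ(x, y) = |U(x) - U(y)|, and V for `potential`. Everything
rests on ℒU(x) - ℒU(x+1) = V(x) u_x: V(x) is the rate at which the slope of U across the edge {x,
x+1} starts to decay under the semigroup.

Lower bound (`backward_contraction`). If c ≤ V, summing over edges shows that e^{-ct}(U(y) - U(x))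
is a supersolution of the equation that P_t f(y) - P_t f(x) solves for the pair generator ℒ_x + ℒ_y
on {x ≤ y}. A maximum principle, confined by a function h with ℒh = 1 and h → ∞, gives ‖P_t f‖ ≤
e^{-ct} for bounded 1-Lipschitz f; truncation and the moment hypothesis remove boundedness. Hence
σ̄(t)/t ≥ inf V for every t > 0.

Upper bound (`eventually_curvatureProfile_div_le`). Testing on U truncated beyond x+2 gives σ̄(t)/t
≤ c for small t whenever V(x) < c. The two bounds yield the infimum over t and the limit at once,
also when inf V = -∞. -/

/-- The cumulative weight `∑_{k < x} u_k`. -/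
def cumWeight (u : ℕ → ℝ) (x : ℕ) : ℝ := ∑ k ∈ Finset.range x, u k

/-- The function `h(x) = ∑_{k < x} μ({0, …, k}) / (μ(k) λ_k)`, which solves `ℒ h = 1`. -/
def lyapunov (lam nu : ℕ → ℝ) (x : ℕ) : ℝ :=
  ∑ k ∈ Finset.range x,
    (∑ y ∈ Finset.range (k + 1), revMeasure lam nu y) * (1 / (revMeasure lam nu k * lam k))

/-- The potential whose infimum is the Wasserstein curvature. -/
def potential (lam nu u : ℕ → ℝ) (x : ℕ) : ℝ :=
  nu (x + 1) + lam x - nu x * (prevWeight u x / u x) - lam (x + 1) * (u (x + 1) / u x)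

lemma cumWeight_succ (u : ℕ → ℝ) (x : ℕ) : cumWeight u (x + 1) = cumWeight u x + u x :=
  Finset.sum_range_succ _ _

lemma cumWeight_mono {u : ℕ → ℝ} (hu : ∀ x, 0 < u x) : Monotone (cumWeight u) :=
  monotone_nat_of_le_succ fun x => by rw [cumWeight_succ]; linarith [hu x]

lemma cumWeight_strictMono {u : ℕ → ℝ} (hu : ∀ x, 0 < u x) : StrictMono (cumWeight u) :=
  strictMono_nat_of_lt_succ fun x => by rw [cumWeight_succ]; linarith [hu x]

lemma weightDist_eq (u : ℕ → ℝ) (x y : ℕ) :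
    weightDist u x y = |cumWeight u x - cumWeight u y| := rfl

lemma weightDist_of_le {u : ℕ → ℝ} (hu : ∀ x, 0 < u x) {x y : ℕ} (h : x ≤ y) :
    weightDist u x y = cumWeight u y - cumWeight u x := by
  rw [weightDist_eq, abs_sub_comm, abs_of_nonneg (sub_nonneg.2 (cumWeight_mono hu h))]

lemma weightDist_comm (u : ℕ → ℝ) (x y : ℕ) : weightDist u x y = weightDist u y x :=
  abs_sub_comm _ _

lemma weightDist_pos {u : ℕ → ℝ} (hu : ∀ x, 0 < u x) {x y : ℕ} (h : x ≠ y) :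
    0 < weightDist u x y :=
  abs_pos.2 (sub_ne_zero.2 fun h' => h ((cumWeight_strictMono hu).injective h'))

/-! ### Lyapunov function, edge identity and maximum principle. -/

section Rates

variable {lam nu : ℕ → ℝ}

lemma IsErgodicRates.death_nonneg (hr : IsErgodicRates lam nu) (x : ℕ) : 0 ≤ nu x := by
  cases x with
  | zero => exact hr.death_zero.ge
  | succ x => exact (hr.death_pos x).le

lemma IsErgodicRates.revMeasure_pos (hr : IsErgodicRates lam nu) (x : ℕ) :
    0 < revMeasure lam nu x :=
  Finset.prod_pos fun k _ => div_pos (hr.birth_pos k) (hr.death_pos k)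

lemma IsErgodicRates.detailed_balance (hr : IsErgodicRates lam nu) (x : ℕ) :
    revMeasure lam nu x * lam x = revMeasure lam nu (x + 1) * nu (x + 1) := by
  have := (hr.death_pos x).ne'
  simp only [revMeasure, Finset.prod_range_succ]
  field_simp

lemma lyapunov_succ (lam nu : ℕ → ℝ) (x : ℕ) : lyapunov lam nu (x + 1) = lyapunov lam nu x +
    (∑ y ∈ Finset.range (x + 1), revMeasure lam nu y) * (1 / (revMeasure lam nu x * lam x)) :=
  Finset.sum_range_succ _ _

lemma IsErgodicRates.lyapunov_increment_nonneg (hr : IsErgodicRates lam nu) (k : ℕ) :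
    0 ≤ (∑ y ∈ Finset.range (k + 1), revMeasure lam nu y) *
      (1 / (revMeasure lam nu k * lam k)) :=
  mul_nonneg (Finset.sum_nonneg fun y _ => (hr.revMeasure_pos y).le)
    (one_div_pos.2 (mul_pos (hr.revMeasure_pos k) (hr.birth_pos k))).le

lemma IsErgodicRates.lyapunov_nonneg (hr : IsErgodicRates lam nu) (x : ℕ) :
    0 ≤ lyapunov lam nu x :=
  Finset.sum_nonneg fun k _ => hr.lyapunov_increment_nonneg k

lemma IsErgodicRates.generator_lyapunov (hr : IsErgodicRates lam nu) (x : ℕ) :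
    generator lam nu (lyapunov lam nu) x = 1 := by
  have hl := (hr.birth_pos x).ne'
  have hm := (hr.revMeasure_pos x).ne'
  cases x with
  | zero =>
    simp only [generator, lyapunov_succ, hr.death_zero]
    simp only [zero_add, Finset.sum_range_one]
    field_simp
    ring
  | succ x =>
    have hb := hr.detailed_balance x
    have hn := (hr.death_pos x).ne'
    simp only [generator, lyapunov_succ, Nat.add_sub_cancel]
    rw [hb, Finset.sum_range_succ _ (x + 1)]
    field_simp
    ring

/-- By Tonelli, the double series in `divergence`, summed in the other order, is the series of
increments of h. -/
lemma IsErgodicRates.tendsto_lyapunov (hr : IsErgodicRates lam nu) :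
    Tendsto (lyapunov lam nu) atTop atTop := by
  refine (not_summable_iff_tendsto_nat_atTop_of_nonneg hr.lyapunov_increment_nonneg).1
    fun hs => ?_
  have key : ∑' x : ℕ, ENNReal.ofReal (revMeasure lam nu x) *
      (∑' y : Set.Ici x, ENNReal.ofReal (1 / (revMeasure lam nu y * lam y))) =
      ∑' y : ℕ, ENNReal.ofReal ((∑ x ∈ Finset.range (y + 1), revMeasure lam nu x) *
        (1 / (revMeasure lam nu y * lam y))) := by
    have h1 : ∀ x : ℕ, ENNReal.ofReal (revMeasure lam nu x) *
        (∑' y : Set.Ici x, ENNReal.ofReal (1 / (revMeasure lam nu y * lam y))) =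
        ∑' y : ℕ, if x ≤ y then ENNReal.ofReal (revMeasure lam nu x) *
          ENNReal.ofReal (1 / (revMeasure lam nu y * lam y)) else 0 := by
      intro x
      rw [tsum_subtype (Set.Ici x) fun y => ENNReal.ofReal (1 / (revMeasure lam nu y * lam y)),
        ← ENNReal.tsum_mul_left]
      refine tsum_congr fun y => ?_
      by_cases hxy : x ≤ y <;> simp [Set.indicator, hxy]
    simp_rw [h1]
    rw [ENNReal.tsum_comm]
    refine tsum_congr fun y => ?_
    rw [tsum_eq_sum (s := Finset.range (y + 1))
      (fun x hx => if_neg fun h => hx (Finset.mem_range.2 (Nat.lt_succ_of_le h))),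
      ENNReal.ofReal_mul (Finset.sum_nonneg fun x _ => (hr.revMeasure_pos x).le),
      ENNReal.ofReal_sum_of_nonneg (fun x _ => (hr.revMeasure_pos x).le), Finset.sum_mul]
    exact Finset.sum_congr rfl fun x hx =>
      if_pos (Nat.le_of_lt_succ (Finset.mem_range.1 hx))
  have h := hr.divergence
  rw [key, ← ENNReal.ofReal_tsum_of_nonneg hr.lyapunov_increment_nonneg hs] at h
  exact ENNReal.ofReal_ne_top h

/-- This is where the formula for the curvature comes from. At x = 0 the convention u_{-1} = 1 plays
no role, since ν_0 = 0. -/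
lemma generator_sub_generator_succ (hr : IsErgodicRates lam nu) {u : ℕ → ℝ}
    (hu : ∀ x, 0 < u x) (x : ℕ) :
    generator lam nu (cumWeight u) x - generator lam nu (cumWeight u) (x + 1) =
      potential lam nu u x * u x := by
  have h := (hu x).ne'
  cases x with
  | zero =>
    simp only [generator, potential, prevWeight, hr.death_zero, cumWeight_succ,
      Nat.add_sub_cancel]
    field_simp
    ring
  | succ x =>
    simp only [generator, potential, prevWeight, cumWeight_succ, Nat.add_sub_cancel]
    field_simp
    ring

lemma generator_cumWeight_sub_le (hr : IsErgodicRates lam nu) {u : ℕ → ℝ}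
    (hu : ∀ x, 0 < u x) {c : ℝ} (hc : ∀ x, c ≤ potential lam nu u x) {x y : ℕ} (hxy : x ≤ y) :
    c * (cumWeight u y - cumWeight u x) ≤
      generator lam nu (cumWeight u) x - generator lam nu (cumWeight u) y := by
  induction y, hxy using Nat.le_induction with
  | base => simp
  | succ y _ ih =>
    have h1 := generator_sub_generator_succ hr hu y
    have h2 := mul_le_mul_of_nonneg_right (hc y) (hu y).le
    rw [cumWeight_succ]
    nlinarith

/-- Contraction of bounded solutions of the backward equation, by a maximum principle for the
pair generator. -/
lemma backward_contraction (hr : IsErgodicRates lam nu) {u : ℕ → ℝ} (hu : ∀ x, 0 < u x)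
    {c : ℝ} (hc : ∀ x, c ≤ potential lam nu u x) {F : ℝ → ℕ → ℝ} {M : ℝ}
    (hM : ∀ t x, |F t x| ≤ M) (hcont : ∀ x, ContinuousOn (fun t => F t x) (Set.Ici 0))
    (hderiv : ∀ t, 0 ≤ t → ∀ x,
      HasDerivWithinAt (fun s => F s x) (generator lam nu (F t) x) (Set.Ioi t) t)
    (h0 : ∀ x y, x ≤ y → F 0 y - F 0 x ≤ cumWeight u y - cumWeight u x)
    {t : ℝ} (ht : 0 ≤ t) {x y : ℕ} (hxy : x ≤ y) :
    F t y - F t x ≤ Real.exp (-c * t) * (cumWeight u y - cumWeight u x) := by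
  set h := lyapunov lam nu with hh
  have hnn : ∀ x, 0 ≤ h x := hr.lyapunov_nonneg
  have hU : ∀ x y, x ≤ y → 0 ≤ cumWeight u y - cumWeight u x := fun x y hxy =>
    sub_nonneg.2 (cumWeight_mono hu hxy)
  -- The penalty ε(h(x) + h(y)) handles far pairs. The pair generator maps it to 2ε, so the slope 3ε
  -- in time leaves a strict margin ε.
  suffices H : ∀ ε > 0, F t y - F t x - Real.exp (-c * t) * (cumWeight u y - cumWeight u x)
      - ε * (h x + h y + 3 * t) ≤ 0 by
    have hlim : Tendsto (fun ε : ℝ => F t y - F t x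
        - Real.exp (-c * t) * (cumWeight u y - cumWeight u x) - ε * (h x + h y + 3 * t))
        (𝓝[>] 0) (𝓝 (F t y - F t x - Real.exp (-c * t) * (cumWeight u y - cumWeight u x)
          - 0 * (h x + h y + 3 * t))) :=
      ((continuous_const.sub (continuous_id.mul continuous_const)).tendsto 0).mono_left
        nhdsWithin_le_nhds
    have := le_of_tendsto hlim (eventually_mem_nhdsWithin.mono fun ε hε => H ε hε)
    linarith
  intro ε hε
  set G : ℝ → ℕ → ℕ → ℝ := fun t x y => F t y - F t x
    - Real.exp (-c * t) * (cumWeight u y - cumWeight u x) - ε * (h x + h y + 3 * t) with hG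
  have hGcont : ∀ x y, ContinuousOn (fun s => G s x y) (Set.Ici 0) := fun x y => by
    have h1 := hcont x
    have h2 := hcont y
    simp only [hG]
    fun_prop
  have hGdiag : ∀ s x, 0 ≤ s → G s x x ≤ 0 := fun s x hs => by
    have := mul_nonneg hε.le (add_nonneg (add_nonneg (hnn x) (hnn x))
      (mul_nonneg zero_le_three hs))
    simp only [hG]
    linarith
  let S : Set ℝ := {s | ∀ x y, x ≤ y → G s x y ≤ 0}
  suffices hS : Set.Icc 0 t ⊆ S from hS ⟨ht, le_rfl⟩ x y hxy
  -- Continuous induction in time: S is closed in [0, t], contains 0, and extends to the right of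
  -- each of its points.
  refine IsClosed.Icc_subset_of_forall_mem_nhdsWithin ?_ ?_ ?_
  · have : S ∩ Set.Icc 0 t = ⋂ (x : ℕ) (y : ℕ) (_ : x ≤ y),
        (Set.Icc 0 t ∩ (fun s => G s x y) ⁻¹' Set.Iic 0) := by
      ext s
      simp only [S, Set.mem_inter_iff, Set.mem_iInter, Set.mem_preimage, Set.mem_Iic,
        Set.mem_ofPred_eq]
      exact ⟨fun hs x y hxy => ⟨hs.2, hs.1 x y hxy⟩,
        fun hs => ⟨fun x y hxy => (hs x y hxy).2, (hs 0 0 le_rfl).1⟩⟩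
    rw [this]
    exact isClosed_iInter fun x => isClosed_iInter fun y => isClosed_iInter fun _ =>
      ((hGcont x y).mono Set.Icc_subset_Ici_self).preimage_isClosed_of_isClosed isClosed_Icc
        isClosed_Iic
  · intro x y hxy
    have h1 := h0 x y hxy
    have h2 := mul_nonneg hε.le (add_nonneg (hnn x) (hnn y))
    simp only [hG, mul_zero, Real.exp_zero]
    linarith
  · rintro s ⟨hsS, hs0, -⟩
    -- For y ≥ N, ε h(y) ≥ 2M dominates F(y) - F(x), so only finitely many pairs need a common right
    -- neighbourhood.
    obtain ⟨N, hN⟩ := eventually_atTop.1 (hr.tendsto_lyapunov.eventually_ge_atTop (2 * M / ε))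
    have hnear : ∀ x y, x < y → ∀ᶠ r in 𝓝[>] s, G r x y ≤ 0 := by
      intro x y hxy
      rcases (hsS x y hxy.le).lt_or_eq with hlt | heq
      · have hc' : ContinuousWithinAt (fun r => G r x y) (Set.Ioi s) s :=
          (hGcont x y s hs0).mono fun r hr => hs0.trans (le_of_lt hr)
        exact (hc'.eventually_lt_const hlt).mono fun r hr => hr.le
      · have hd : HasDerivWithinAt (fun r => G r x y)
            (generator lam nu (F s) y - generator lam nu (F s) x
              - (Real.exp (-c * s) * (-c)) * (cumWeight u y - cumWeight u x) - ε * 3)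
            (Set.Ioi s) s := by
          have e1 : HasDerivAt (fun r : ℝ => Real.exp (-c * r)) (Real.exp (-c * s) * (-c)) s := by
            simpa using ((hasDerivAt_id s).const_mul (-c)).exp
          have e2 : HasDerivAt (fun r : ℝ => ε * (h x + h y + 3 * r)) (ε * 3) s := by
            simpa using (((hasDerivAt_id s).const_mul 3).const_add (h x + h y)).const_mul ε
          exact (((hderiv s hs0 y).sub (hderiv s hs0 x)).sub
            (e1.hasDerivWithinAt.mul_const _)).sub e2.hasDerivWithinAt
        have hneg : generator lam nu (F s) y - generator lam nu (F s) x
              - (Real.exp (-c * s) * (-c)) * (cumWeight u y - cumWeight u x) - ε * 3 < 0 := by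
          -- G vanishes at (x, y), its maximum over ordered pairs. As x < y, moving one coordinate
          -- by one step preserves the order, so each jump term of the pair generator is
          -- nonpositive.
          have g1 := mul_nonneg (hr.birth_pos y).le
            (sub_nonneg.2 ((hsS x (y + 1) (by omega)).trans heq.ge))
          have g2 := mul_nonneg (hr.death_nonneg y)
            (sub_nonneg.2 ((hsS x (y - 1) (by omega)).trans heq.ge))
          have g3 := mul_nonneg (hr.birth_pos x).le
            (sub_nonneg.2 ((hsS (x + 1) y (by omega)).trans heq.ge))
          have g4 := mul_nonneg (hr.death_nonneg x)
            (sub_nonneg.2 ((hsS (x - 1) y (by omega)).trans heq.ge))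
          have l1 := hr.generator_lyapunov x
          have l2 := hr.generator_lyapunov y
          have k := mul_le_mul_of_nonneg_left (generator_cumWeight_sub_le hr hu hc hxy.le)
            (Real.exp_pos (-c * s)).le
          have l3 : ε * (generator lam nu h x + generator lam nu h y) = ε * 2 := by
            rw [l1, l2]; norm_num
          simp only [generator, hG] at *
          linarith
        have hslope := (hasDerivWithinAt_iff_tendsto_slope' (by simp)).1 hd
        filter_upwards [hslope.eventually_lt_const hneg, self_mem_nhdsWithin] with r hr1 hr2
        rw [slope_def_field, heq, sub_zero, div_lt_iff₀ (sub_pos.2 hr2), zero_mul] at hr1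
        exact hr1.le
    have hfin : ∀ᶠ r in 𝓝[>] s, ∀ x ∈ Set.Iio N, ∀ y ∈ Set.Iio N, x < y → G r x y ≤ 0 := by
      rw [eventually_all_finite (Set.finite_Iio N)]
      intro x _
      rw [eventually_all_finite (Set.finite_Iio N)]
      intro y _
      by_cases hxy : x < y
      · exact (hnear x y hxy).mono fun r hr _ => hr
      · exact Eventually.of_forall fun r h => absurd h hxy
    filter_upwards [hfin, self_mem_nhdsWithin] with r hr1 hr2
    intro x y hxy
    have hr0 : 0 ≤ r := hs0.trans (le_of_lt hr2)
    rcases hxy.eq_or_lt with rfl | hlt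
    · exact hGdiag r x hr0
    by_cases hy : y < N
    · exact hr1 x (hlt.trans hy) y hy hlt
    · have a1 := (div_le_iff₀ hε).1 (hN y (not_lt.1 hy))
      have a2 := abs_le.1 (hM r y)
      have a3 := abs_le.1 (hM r x)
      have a4 := mul_nonneg (Real.exp_pos (-c * r)).le (hU x y hxy)
      have a5 := mul_nonneg hε.le (hnn x)
      have a6 := mul_nonneg hε.le (mul_nonneg zero_le_three hr0)
      simp only [hG]
      linarith

end Rates

/-! ### Semigroup property, continuity and backward equation on bounded functions. -/

open ProbabilityTheory

section Semigroup

variable {Ω : Type*} [mΩ : MeasurableSpace Ω] {ℱ : Filtration ℝ≥0 mΩ} {Pr : ℕ → Measure Ω}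
  {X : ℝ≥0 → Ω → ℕ}

/-- The transition probabilities of a process on `ℕ` as a kernel. -/
def transitionKernel (Pr : ℕ → Measure Ω) (X : ℝ≥0 → Ω → ℕ) (t : ℝ≥0) : Kernel ℕ ℕ :=
  ⟨transition Pr X t, .of_discrete⟩

lemma IsMarkovProcess.measurable (hX : IsMarkovProcess ℱ Pr X) (t : ℝ≥0) : Measurable (X t) :=
  (hX.adapted t).mono (ℱ.le t) le_rfl

lemma IsMarkovProcess.isProbabilityMeasure_transition (hX : IsMarkovProcess ℱ Pr X) (t : ℝ≥0)
    (x : ℕ) : IsProbabilityMeasure (transition Pr X t x) :=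
  have := hX.isProbabilityMeasure x
  Measure.isProbabilityMeasure_map (hX.measurable t).aemeasurable

lemma IsMarkovProcess.transition_zero (hX : IsMarkovProcess ℱ Pr X) (x : ℕ) :
    transition Pr X 0 x = Measure.dirac x := by
  have := hX.isProbabilityMeasure x
  have h : X 0 =ᵐ[Pr x] fun _ => x := hX.start x
  rw [transition, Measure.map_congr h, Measure.map_const, measure_univ, one_smul]

lemma integrable_of_abs_le {m : Measure ℕ} [IsFiniteMeasure m] {f : ℕ → ℝ} {M : ℝ}
    (hf : ∀ x, |f x| ≤ M) : Integrable f m :=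
  Integrable.of_bound measurable_from_top.aestronglyMeasurable M (ae_of_all _ hf)

/-- The Chapman–Kolmogorov equation. -/
lemma IsMarkovProcess.transition_add (hX : IsMarkovProcess ℱ Pr X) (s t : ℝ≥0) (x : ℕ) :
    transition Pr X (s + t) x = (transitionKernel Pr X t ∘ₖ transitionKernel Pr X s) x := by
  have := hX.isProbabilityMeasure x
  have := hX.isProbabilityMeasure_transition (s + t) x
  have := hX.isProbabilityMeasure_transition s x
  have := hX.isProbabilityMeasure_transition t
  ext A hA
  have h1 : (transition Pr X (s + t) x).real A =
      ∫ y, (transition Pr X t y).real A ∂(transition Pr X s x) := by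
    rw [transition.eq_1 Pr X s x, integral_map (hX.measurable s).aemeasurable
      measurable_from_top.aestronglyMeasurable, transition.eq_1 Pr X (s + t) x, ← integral_congr_ae (hX.markov x s t A hA),
      integral_condExp (ℱ.le s)]
    rw [map_measureReal_apply (hX.measurable _) hA]
    exact (integral_indicator_one (hX.measurable _ hA)).symm
  rw [Kernel.comp_apply' _ _ _ hA, ← ofReal_measureReal, h1, ofReal_integral_eq_lintegral_ofReal
    (integrable_of_abs_le (M := 1) fun y => by
      rw [abs_of_nonneg measureReal_nonneg]; exact measureReal_le_one)
    (ae_of_all _ fun y => measureReal_nonneg)]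
  exact lintegral_congr fun y => ofReal_measureReal

lemma IsMarkovProcess.abs_semigroup_le (hX : IsMarkovProcess ℱ Pr X) {f : ℕ → ℝ} {M : ℝ}
    (hf : ∀ x, |f x| ≤ M) (t : ℝ≥0) (x : ℕ) : |semigroup Pr X t f x| ≤ M := by
  have := hX.isProbabilityMeasure_transition t x
  simpa [semigroup] using
    norm_integral_le_of_norm_le_const (μ := transition Pr X t x) (f := f) (ae_of_all _ hf)

lemma IsMarkovProcess.semigroup_zero (hX : IsMarkovProcess ℱ Pr X) (f : ℕ → ℝ) (x : ℕ) :
    semigroup Pr X 0 f x = f x := by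
  rw [semigroup, hX.transition_zero, integral_dirac]

lemma IsMarkovProcess.semigroup_add (hX : IsMarkovProcess ℱ Pr X) {f : ℕ → ℝ} {M : ℝ}
    (hf : ∀ x, |f x| ≤ M) (s t : ℝ≥0) (x : ℕ) :
    semigroup Pr X (s + t) f x = semigroup Pr X s (semigroup Pr X t f) x := by
  have := hX.isProbabilityMeasure_transition (s + t) x
  have hi : Integrable f (transition Pr X (s + t) x) := integrable_of_abs_le hf
  rw [hX.transition_add] at hi
  rw [semigroup, hX.transition_add, Kernel.integral_comp hi]
  rfl

lemma IsMarkovProcess.abs_semigroup_sub_le (hX : IsMarkovProcess ℱ Pr X) {g : ℕ → ℝ} {M : ℝ}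
    (hg : ∀ x, |g x| ≤ M) (s : ℝ≥0) (x : ℕ) :
    |semigroup Pr X s g x - g x| ≤ 2 * M * (transition Pr X s x).real {x}ᶜ := by
  have := hX.isProbabilityMeasure_transition s x
  have h1 : semigroup Pr X s g x - g x = ∫ y, (g y - g x) ∂(transition Pr X s x) := by
    rw [integral_sub (integrable_of_abs_le hg) (integrable_const _)]
    simp [semigroup]
  have h2 : ∫ y, (g y - g x) ∂(transition Pr X s x) =
      ∫ y in {x}ᶜ, (g y - g x) ∂(transition Pr X s x) :=
    (setIntegral_eq_integral_of_forall_compl_eq_zero fun y hy => by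
      have : y = x := by simpa using hy
      simp [this]).symm
  rw [h1, h2, ← Real.norm_eq_abs]
  refine norm_setIntegral_le_of_norm_le_const (measure_lt_top _ _) fun y _ => ?_
  have a1 := abs_le.1 (hg x)
  have a2 := abs_le.1 (hg y)
  exact abs_le.2 ⟨by linarith, by linarith⟩

variable {lam nu : ℕ → ℝ}

/-- Since ℒ sees only x and its neighbours, the rates of singletons determine ℒg(x). -/
lemma sum_mul_generator_indicator (lam nu g : ℕ → ℝ) (x : ℕ) :
    ∑ y ∈ Finset.Icc (x - 1) (x + 1),
      g y * generator lam nu (({y} : Set ℕ).indicator fun _ => (1 : ℝ)) x =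
      generator lam nu g x := by
  have h : ∀ z ∈ Finset.Icc (x - 1) (x + 1), ∑ y ∈ Finset.Icc (x - 1) (x + 1),
      g y * ({y} : Set ℕ).indicator (fun _ => (1 : ℝ)) z = g z := by
    intro z hz
    rw [Finset.sum_eq_single z]
    · simp
    · intro y _ hy
      simp [hy.symm]
    · exact fun h => absurd hz h
  have e0 := h x (by simp)
  have e1 := h (x + 1) (by simp; omega)
  have e2 := h (x - 1) (by simp; omega)
  simp only [generator]
  conv_rhs => rw [← e0, ← e1, ← e2]
  simp only [mul_sub, mul_add, Finset.mul_sum, Finset.sum_add_distrib, Finset.sum_sub_distrib]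
  simp only [mul_left_comm]

/-- The generator is the derivative at `0` of the semigroup on bounded functions. -/
lemma IsBirthDeathProcess.tendsto_generator (hX : IsBirthDeathProcess lam nu ℱ Pr X) {g : ℕ → ℝ}
    {M : ℝ} (hg : ∀ x, |g x| ≤ M) (x : ℕ) :
    Tendsto (fun s : ℝ≥0 => (semigroup Pr X s g x - g x) / (s : ℝ)) (𝓝[>] 0)
      (𝓝 (generator lam nu g x)) := by
  set W : Finset ℕ := Finset.Icc (x - 1) (x + 1) with hW
  have hxW : x ∈ W := by simp [hW]
  have hxW1 : x + 1 ∈ W := by simp [hW]; omega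
  have hxW2 : x - 1 ∈ W := by simp [hW]; omega
  have h1 : Tendsto (fun s : ℝ≥0 => ∑ y ∈ W, g y * (((transition Pr X s x).real {y} -
      ({y} : Set ℕ).indicator (fun _ => (1 : ℝ)) x) / (s : ℝ))) (𝓝[>] 0)
      (𝓝 (generator lam nu g x)) := by
    rw [← sum_mul_generator_indicator]
    exact tendsto_finsetSum _ fun y _ => (hX.rates x {y}).const_mul _
  -- The mass outside the window W is o(s), because ℒ1_{Wᶜ}(x) = 0; boundedness of g then makes the
  -- tail negligible.
  have h2 : Tendsto (fun s : ℝ≥0 =>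
      (∫ y in (W : Set ℕ)ᶜ, g y ∂(transition Pr X s x)) / (s : ℝ)) (𝓝[>] 0) (𝓝 0) := by
    have h3 := (hX.rates x (W : Set ℕ)ᶜ).const_mul M
    have h4 : generator lam nu ((W : Set ℕ)ᶜ.indicator fun _ => (1 : ℝ)) x = 0 := by
      simp [generator, hxW, hxW1, hxW2]
    rw [h4, mul_zero] at h3
    refine squeeze_zero_norm (fun s => ?_) h3
    have := hX.isProbabilityMeasure_transition s x
    have h5 := norm_setIntegral_le_of_norm_le_const (μ := transition Pr X s x) (f := g)
      (s := (W : Set ℕ)ᶜ) (measure_lt_top _ _) (fun y _ => hg y)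
    rw [norm_div, Real.norm_of_nonneg s.coe_nonneg, mul_div_assoc']
    refine div_le_div_of_nonneg_right ?_ s.coe_nonneg
    simpa [hxW] using h5
  have h6 := h1.add h2
  rw [add_zero] at h6
  refine h6.congr fun s => ?_
  have := hX.isProbabilityMeasure_transition s x
  have h7 : semigroup Pr X s g x = ∑ y ∈ W, g y * (transition Pr X s x).real {y} +
      ∫ y in (W : Set ℕ)ᶜ, g y ∂(transition Pr X s x) := by
    rw [semigroup, ← integral_add_compl W.measurableSet (integrable_of_abs_le hg),
      setIntegral_finset W (integrable_of_abs_le hg).integrableOn]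
    simp [mul_comm]
  have h8 : ∑ y ∈ W, g y * ({y} : Set ℕ).indicator (fun _ => (1 : ℝ)) x = g x := by
    rw [Finset.sum_eq_single x]
    · simp
    · intro y _ hy
      simp [hy.symm]
    · exact fun h => absurd hxW h
  rw [h7]
  conv_rhs => rw [← h8]
  simp only [mul_div_assoc', ← Finset.sum_div, mul_sub, Finset.sum_sub_distrib]
  ring

lemma IsBirthDeathProcess.tendsto_transition_compl (hX : IsBirthDeathProcess lam nu ℱ Pr X)
    (x : ℕ) : Tendsto (fun s : ℝ≥0 => (transition Pr X s x).real {x}ᶜ) (𝓝 0) (𝓝 0) := by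
  have h0 : (transition Pr X 0 x).real {x}ᶜ = 0 := by
    rw [hX.transition_zero]
    simp [measureReal_def]
  have h1 : Tendsto (fun s : ℝ≥0 => (transition Pr X s x).real {x}ᶜ) (𝓝[>] 0) (𝓝 0) := by
    have h2 := hX.rates x {x}ᶜ
    have h3 : Tendsto (fun s : ℝ≥0 => (s : ℝ)) (𝓝[>] 0) (𝓝 0) :=
      (NNReal.continuous_coe.tendsto 0).mono_left nhdsWithin_le_nhds
    have h4 := h2.mul h3
    rw [mul_zero] at h4
    refine h4.congr' (eventually_mem_nhdsWithin.mono fun s hs => ?_)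
    have : (s : ℝ) ≠ 0 := NNReal.coe_ne_zero.2 (ne_of_gt hs)
    simp [this]
  have h5 : ContinuousWithinAt (fun s : ℝ≥0 => (transition Pr X s x).real {x}ᶜ)
      (Set.Ioi 0) 0 := by
    rw [ContinuousWithinAt, h0]
    exact h1
  rw [continuousWithinAt_Ioi_iff_Ici] at h5
  have h6 : Set.Ici (0 : ℝ≥0) = Set.univ := Set.eq_univ_of_forall fun s => Set.mem_Ici.2 zero_le
  rw [h6, continuousWithinAt_univ, ContinuousAt, h0] at h5
  exact h5

/-- For s ≤ t, P_t f = P_{t-s}(P_s f), so the increment is controlled by the probability of being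
away from x at time t - s. This modulus is symmetric, hence continuity from both sides. -/
lemma IsBirthDeathProcess.continuous_semigroup (hX : IsBirthDeathProcess lam nu ℱ Pr X)
    {f : ℕ → ℝ} {M : ℝ} (hf : ∀ x, |f x| ≤ M) (x : ℕ) :
    Continuous fun t : ℝ≥0 => semigroup Pr X t f x := by
  have hle : ∀ s t : ℝ≥0, s ≤ t → dist (semigroup Pr X t f x) (semigroup Pr X s f x) ≤
      2 * M * (transition Pr X (nndist t s) x).real {x}ᶜ := by
    intro s t hst
    have h1 : nndist t s = t - s := by
      rw [NNReal.nndist_eq, tsub_eq_zero_of_le hst, max_eq_left zero_le]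
    have h2 := hX.abs_semigroup_sub_le (hX.abs_semigroup_le hf s) (t - s) x
    rwa [← hX.semigroup_add hf, tsub_add_cancel_of_le hst, ← h1] at h2
  rw [continuous_iff_continuousAt]
  intro s
  rw [ContinuousAt, tendsto_iff_dist_tendsto_zero]
  have h3 : Tendsto (fun t => nndist t s) (𝓝 s) (𝓝 0) := by
    have : Continuous fun t => nndist t s := by fun_prop
    simpa using this.tendsto s
  have h4 := ((hX.tendsto_transition_compl x).comp h3).const_mul (2 * M)
  rw [mul_zero] at h4
  refine squeeze_zero (fun _ => dist_nonneg) (fun t => ?_) h4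
  rcases le_total s t with h | h
  · exact hle s t h
  · have := hle t s h
    rwa [dist_comm, nndist_comm] at this

/-- The increment r - t acts first from x, P_r f = P_{r-t}(P_t f), so the derivative at 0 applies to
the bounded function P_t f. -/
lemma IsBirthDeathProcess.hasDerivWithinAt_semigroup (hX : IsBirthDeathProcess lam nu ℱ Pr X)
    {f : ℕ → ℝ} {M : ℝ} (hf : ∀ x, |f x| ≤ M) (x : ℕ) {t : ℝ} (ht : 0 ≤ t) :
    HasDerivWithinAt (fun s : ℝ => semigroup Pr X s.toNNReal f x)
      (generator lam nu (semigroup Pr X t.toNNReal f) x) (Set.Ioi t) t := by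
  rw [hasDerivWithinAt_iff_tendsto_slope' (by simp)]
  have h1 : Tendsto (fun r : ℝ => (r - t).toNNReal) (𝓝[>] t) (𝓝[>] 0) := by
    refine tendsto_nhdsWithin_iff.2 ⟨?_, eventually_mem_nhdsWithin.mono fun r hr =>
      Real.toNNReal_pos.2 (sub_pos.2 hr)⟩
    have : Continuous fun r : ℝ => (r - t).toNNReal := by fun_prop
    simpa using (this.tendsto t).mono_left nhdsWithin_le_nhds
  refine ((hX.tendsto_generator (hX.abs_semigroup_le hf t.toNNReal) x).comp h1).congr'
    (eventually_mem_nhdsWithin.mono fun r hr => ?_)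
  have hrt : 0 ≤ r - t := sub_nonneg.2 (le_of_lt hr)
  rw [Function.comp_apply, ← hX.semigroup_add hf, ← Real.toNNReal_add hrt ht, sub_add_cancel,
    Real.coe_toNNReal _ hrt, slope_def_field]

end Semigroup

/-! ### Lipschitz seminorm for δ and truncations. -/

section Lipschitz

variable {u : ℕ → ℝ}

lemma abs_sub_le_of_lipSeminorm_le_one (hu : ∀ x, 0 < u x) {f : ℕ → ℝ}
    (hf : lipSeminorm (weightDist u) f ≤ 1) (x y : ℕ) : |f x - f y| ≤ weightDist u x y := by
  rcases eq_or_ne x y with rfl | h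
  · simp [weightDist]
  have h1 : ENNReal.ofReal (|f x - f y| / weightDist u x y) ≤ 1 :=
    by
    refine le_trans ?_ hf
    exact le_iSup_of_le x (le_iSup_of_le y (le_iSup_of_le h le_rfl))
  rw [← ENNReal.ofReal_one, ENNReal.ofReal_le_ofReal_iff zero_le_one,
    div_le_one (weightDist_pos hu h)] at h1
  exact h1

lemma lipSeminorm_le (hu : ∀ x, 0 < u x) {f : ℕ → ℝ} {C : ℝ}
    (hf : ∀ x y, x ≤ y → |f y - f x| ≤ C * (cumWeight u y - cumWeight u x)) :
    lipSeminorm (weightDist u) f ≤ ENNReal.ofReal C := by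
  refine iSup_le fun x => iSup_le fun y => iSup_le fun h => ENNReal.ofReal_le_ofReal ?_
  rw [div_le_iff₀ (weightDist_pos hu h)]
  rcases le_total x y with hxy | hxy
  · rw [weightDist_of_le hu hxy, abs_sub_comm]
    exact hf x y hxy
  · rw [weightDist_comm, weightDist_of_le hu hxy]
    exact hf y x hxy

lemma le_lipSeminorm (hu : ∀ x, 0 < u x) (f : ℕ → ℝ) (x : ℕ) :
    ENNReal.ofReal ((f (x + 1) - f x) / u x) ≤ lipSeminorm (weightDist u) f := by
  refine le_trans (ENNReal.ofReal_le_ofReal ?_)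
    (le_iSup_of_le x (le_iSup_of_le (x + 1) (le_iSup_of_le x.succ_ne_self.symm le_rfl)))
  rw [weightDist_of_le hu x.le_succ, cumWeight_succ, add_sub_cancel_left, abs_sub_comm]
  exact div_le_div_of_nonneg_right (le_abs_self _) (hu x).le

lemma abs_cumWeight_min_sub_le (hu : ∀ x, 0 < u x) (N : ℕ) {x y : ℕ} (hxy : x ≤ y) :
    |cumWeight u (min y N) - cumWeight u (min x N)| ≤ cumWeight u y - cumWeight u x := by
  have hm := cumWeight_mono hu
  rw [abs_of_nonneg (sub_nonneg.2 (hm (min_le_min_right N hxy)))]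
  rcases le_total x N with hx | hx
  · rw [min_eq_left hx]
    linarith [hm (min_le_left y N)]
  · rw [min_eq_right hx, min_eq_right (hx.trans hxy)]
    linarith [hm hxy]

/-- The edge {0, 1}, untouched by the truncation when N ≥ 1, already attains slope 1. -/
lemma lipSeminorm_cumWeight_min (hu : ∀ x, 0 < u x) {N : ℕ} (hN : 1 ≤ N) :
    lipSeminorm (weightDist u) (fun y => cumWeight u (min y N)) = 1 := by
  refine le_antisymm ?_ ?_
  · rw [← ENNReal.ofReal_one]
    refine lipSeminorm_le hu fun x y hxy => ?_
    rw [one_mul]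
    exact abs_cumWeight_min_sub_le hu N hxy
  · have h := le_lipSeminorm hu (fun y => cumWeight u (min y N)) 0
    simpa [hN, cumWeight, (hu 0).ne'] using h

/-- Truncating an integrable Lipschitz function. -/
lemma tendsto_integral_truncate {m : Measure ℕ} {f : ℕ → ℝ} (hf : Integrable f m) :
    Tendsto (fun n : ℕ => ∫ y, max (-(n : ℝ)) (min (f y) n) ∂m) atTop (𝓝 (∫ y, f y ∂m)) := by
  refine tendsto_integral_of_dominated_convergence (fun y => |f y|)
    (fun n => measurable_from_top.aestronglyMeasurable) hf.abs
    (fun n => ae_of_all _ fun y => ?_) (ae_of_all _ fun y => ?_)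
  · have hn : (0 : ℝ) ≤ n := n.cast_nonneg
    rw [Real.norm_eq_abs, abs_le]
    have h1 := neg_abs_le (f y)
    have h2 := le_abs_self (f y)
    have h3 := abs_nonneg (f y)
    refine ⟨?_, max_le (by linarith) ((min_le_left _ _).trans h2)⟩
    exact le_max_of_le_right (le_min h1 (by linarith))
  · obtain ⟨n, hn⟩ := exists_nat_ge |f y|
    refine tendsto_const_nhds.congr' ((eventually_ge_atTop n).mono fun k hk => ?_)
    have hk' : |f y| ≤ k := hn.trans (Nat.cast_le.2 hk)
    have h1 := abs_le.1 hk'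
    beta_reduce
    rw [min_eq_left h1.2, max_eq_right h1.1]

end Lipschitz

/-! ### The two bounds on the curvature profile. -/

section Contraction

variable {Ω : Type*} [mΩ : MeasurableSpace Ω] {ℱ : Filtration ℝ≥0 mΩ} {Pr : ℕ → Measure Ω}
  {X : ℝ≥0 → Ω → ℕ} {lam nu u : ℕ → ℝ}

/-- Contraction of the semigroup on bounded functions which are one-sidedly `1`-Lipschitz. -/
lemma IsBirthDeathProcess.semigroup_sub_le_of_bounded (hX : IsBirthDeathProcess lam nu ℱ Pr X)
    (hr : IsErgodicRates lam nu) (hu : ∀ x, 0 < u x) {c : ℝ}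
    (hc : ∀ x, c ≤ potential lam nu u x) {f : ℕ → ℝ} {M : ℝ} (hM : ∀ x, |f x| ≤ M)
    (hf : ∀ x y, x ≤ y → f y - f x ≤ cumWeight u y - cumWeight u x) (t : ℝ≥0) {x y : ℕ}
    (hxy : x ≤ y) : semigroup Pr X t f y - semigroup Pr X t f x ≤
      Real.exp (-c * t) * (cumWeight u y - cumWeight u x) := by
  have h := backward_contraction hr hu hc (F := fun s => semigroup Pr X s.toNNReal f)
    (fun s => hX.abs_semigroup_le hM s.toNNReal)
    (fun x => ((hX.continuous_semigroup hM x).comp continuous_real_toNNReal).continuousOn)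
    (fun s hs x => hX.hasDerivWithinAt_semigroup hM x hs)
    (fun x y hxy => by simpa [hX.semigroup_zero] using hf x y hxy) t.coe_nonneg hxy
  simpa using h

lemma IsBirthDeathProcess.abs_semigroup_sub_le_of_lipschitz
    (hX : IsBirthDeathProcess lam nu ℱ Pr X)
    (hr : IsErgodicRates lam nu) (hu : ∀ x, 0 < u x) {c : ℝ}
    (hc : ∀ x, c ≤ potential lam nu u x) {f : ℕ → ℝ}
    (hf : ∀ x y, |f x - f y| ≤ weightDist u x y) {t : ℝ≥0}
    (hm : ∀ x, HasFiniteMoment (weightDist u) (transition Pr X t x)) {x y : ℕ} (hxy : x ≤ y) :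
    |semigroup Pr X t f y - semigroup Pr X t f x| ≤
      Real.exp (-c * t) * (cumWeight u y - cumWeight u x) := by
  have hint : ∀ x, Integrable f (transition Pr X t x) := by
    intro x
    have := hX.isProbabilityMeasure_transition t x
    obtain ⟨z, hz⟩ := hm x
    refine ((integrable_const |f z|).add hz).mono' measurable_from_top.aestronglyMeasurable
      (ae_of_all _ fun y => ?_)
    have h1 := hf z y
    have h2 := abs_sub_abs_le_abs_sub (f y) (f z)
    rw [abs_sub_comm] at h2
    simp only [Pi.add_apply, Real.norm_eq_abs]
    linarith
  -- Clipping to [-n, n] keeps f 1-Lipschitz; the one-sided bound for g and -g gives the absolute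
  -- value, and dominated convergence lets n → ∞.
  let g : ℕ → ℕ → ℝ := fun n y => max (-(n : ℝ)) (min (f y) n)
  have hg : ∀ n x, |g n x| ≤ n := fun n x => by
    have hn : (0 : ℝ) ≤ n := n.cast_nonneg
    exact abs_le.2 ⟨le_max_left _ _, max_le (by linarith) (min_le_right _ _)⟩
  have hglip : ∀ n x y, x ≤ y → |g n y - g n x| ≤ cumWeight u y - cumWeight u x := by
    intro n x y hxy
    refine (abs_max_sub_max_le_max _ _ _ _).trans ?_
    rw [sub_self, abs_zero]
    refine max_le (sub_nonneg.2 (cumWeight_mono hu hxy)) ?_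
    refine (abs_min_sub_min_le_max _ _ _ _).trans ?_
    rw [sub_self, abs_zero]
    refine max_le ?_ (sub_nonneg.2 (cumWeight_mono hu hxy))
    rw [abs_sub_comm, ← weightDist_of_le hu hxy]
    exact hf x y
  have hlim : ∀ x, Tendsto (fun n => semigroup Pr X t (g n) x) atTop
      (𝓝 (semigroup Pr X t f x)) := fun x => tendsto_integral_truncate (hint x)
  refine le_of_tendsto ((hlim y).sub (hlim x)).abs (Eventually.of_forall fun n => ?_)
  have h1 := hX.semigroup_sub_le_of_bounded hr hu hc (hg n)
    (fun x y hxy => (abs_le.1 (hglip n x y hxy)).2) t hxy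
  have h2 := hX.semigroup_sub_le_of_bounded hr hu hc (f := fun x => -g n x)
    (fun x => by rw [abs_neg]; exact hg n x)
    (fun x y hxy => by linarith [(abs_le.1 (hglip n x y hxy)).1]) t hxy
  have h3 : ∀ x, semigroup Pr X t (fun x => -g n x) x = -semigroup Pr X t (g n) x :=
    fun x => integral_neg _
  rw [h3, h3] at h2
  exact abs_le.2 ⟨by linarith, h1⟩

lemma IsBirthDeathProcess.le_curvatureProfile_div (hX : IsBirthDeathProcess lam nu ℱ Pr X)
    (hr : IsErgodicRates lam nu) (hu : ∀ x, 0 < u x) {c : ℝ}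
    (hc : ∀ x, c ≤ potential lam nu u x) {t : ℝ≥0} (ht : 0 < t)
    (hm : ∀ x, HasFiniteMoment (weightDist u) (transition Pr X t x)) :
    (c : EReal) ≤ curvatureProfile (weightDist u) (semigroup Pr X) t / ((t : ℝ) : EReal) := by
  rw [EReal.le_div_iff_mul_le (by exact_mod_cast ht) (EReal.coe_ne_top _), curvatureProfile,
    EReal.le_neg, ← EReal.coe_mul, ← EReal.coe_neg]
  refine iSup_le fun f => iSup_le fun hf => ?_
  have h1 := lipSeminorm_le hu fun x y hxy => hX.abs_semigroup_sub_le_of_lipschitz hr hu hc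
    (abs_sub_le_of_lipSeminorm_le_one hu hf.le) hm hxy
  refine (ENNReal.log_le_log h1).trans ?_
  rw [ENNReal.log_ofReal_of_pos (Real.exp_pos _), Real.log_exp, neg_mul]

lemma IsBirthDeathProcess.eventually_curvatureProfile_div_le
    (hX : IsBirthDeathProcess lam nu ℱ Pr X) (hr : IsErgodicRates lam nu) (hu : ∀ x, 0 < u x)
    {c : ℝ} {x : ℕ} (hc : potential lam nu u x < c) :
    ∀ᶠ t : ℝ≥0 in 𝓝[>] 0,
      curvatureProfile (weightDist u) (semigroup Pr X) t / ((t : ℝ) : EReal) ≤ c := by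
  have hux := hu x
  -- x + 2 is the largest site seen by ℒ at x + 1, so truncating there makes f bounded without
  -- changing ℒf at x or x + 1.
  set f : ℕ → ℝ := fun y => cumWeight u (min y (x + 2)) with hf
  have hfeq : ∀ y ≤ x + 2, f y = cumWeight u y := fun y hy => by simp [hf, hy]
  have hM : ∀ y, |f y| ≤ cumWeight u (x + 2) := fun y => by
    have h0 : 0 ≤ f y := Finset.sum_nonneg fun k _ => (hu k).le
    rw [abs_of_nonneg h0]
    exact cumWeight_mono hu (min_le_right _ _)
  have hgen : generator lam nu f (x + 1) - generator lam nu f x = -potential lam nu u x * u x := by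
    rw [neg_mul, ← generator_sub_generator_succ hr hu]
    simp only [generator]
    rw [hfeq (x + 1 + 1) le_rfl, hfeq (x + 1) (by omega), hfeq (x + 1 - 1) (by omega),
      hfeq x (by omega), hfeq (x - 1) (by omega)]
    ring
  have h1 : Tendsto (fun t : ℝ≥0 =>
      ((semigroup Pr X t f (x + 1) - semigroup Pr X t f x) / u x - 1) / (t : ℝ)) (𝓝[>] 0)
      (𝓝 (-potential lam nu u x)) := by
    have h := ((hX.tendsto_generator hM (x + 1)).sub (hX.tendsto_generator hM x)).div_const (u x)
    rw [hgen, mul_div_cancel_right₀ _ hux.ne'] at h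
    refine h.congr fun t => ?_
    rw [hfeq (x + 1) (by omega), hfeq x (by omega), cumWeight_succ]
    field_simp
    ring
  have h2 : Tendsto (fun t : ℝ≥0 => (Real.exp (-c * t) - 1) / (t : ℝ)) (𝓝[>] 0) (𝓝 (-c)) := by
    have hd : HasDerivAt (fun r : ℝ => Real.exp (-c * r)) (-c) 0 := by
      simpa using ((hasDerivAt_id (0 : ℝ)).const_mul (-c)).exp
    have h3 : Tendsto (fun t : ℝ≥0 => (t : ℝ)) (𝓝[>] 0) (𝓝[≠] 0) :=
      tendsto_nhdsWithin_iff.2 ⟨(NNReal.continuous_coe.tendsto 0).mono_left nhdsWithin_le_nhds,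
        eventually_mem_nhdsWithin.mono fun t ht => NNReal.coe_ne_zero.2 (ne_of_gt ht)⟩
    refine ((hasDerivAt_iff_tendsto_slope.1 hd).comp h3).congr fun t => ?_
    simp [slope_def_field]
  -- To first order the slope of P_t f across {x, x+1} is 1 - V(x)t, which beats e^{-ct} for small
  -- t.
  filter_upwards [h2.eventually_lt h1 (neg_lt_neg hc), self_mem_nhdsWithin] with t h3 ht
  have ht' : (0 : ℝ) < t := by exact_mod_cast ht
  rw [div_lt_div_iff_of_pos_right ht', sub_lt_sub_iff_right] at h3
  rw [EReal.div_le_iff_le_mul (by exact_mod_cast ht') (EReal.coe_ne_top _), curvatureProfile,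
    EReal.neg_le, ← EReal.coe_mul, ← EReal.coe_neg]
  refine le_iSup_of_le f (le_iSup_of_le (lipSeminorm_cumWeight_min hu (by omega)) ?_)
  refine le_trans ?_ (ENNReal.log_le_log
    ((ENNReal.ofReal_le_ofReal h3.le).trans (le_lipSeminorm hu (semigroup Pr X t f) x)))
  rw [ENNReal.log_ofReal_of_pos (Real.exp_pos _), Real.log_exp, neg_mul, mul_comm]

end Contraction

end BirthDeath

end

/-! ### Conclusion in the extended reals. -/

theorem theorem4p3 {Ω : Type*} [mΩ : MeasurableSpace Ω] (lam nu u : ℕ → ℝ)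
    (hrates : BirthDeath.IsErgodicRates lam nu) (hu : ∀ x, 0 < u x)
    (ℱ : Filtration ℝ≥0 mΩ) (Pr : ℕ → Measure Ω) (X : ℝ≥0 → Ω → ℕ)
    (hX : BirthDeath.IsBirthDeathProcess lam nu ℱ Pr X)
    (hmoment : ∀ (t : ℝ≥0) (x : ℕ), 0 < t →
      BirthDeath.HasFiniteMoment (BirthDeath.weightDist u) (BirthDeath.transition Pr X t x)) :
    Tendsto (fun t : ℝ≥0 =>
        BirthDeath.curvatureProfile (BirthDeath.weightDist u) (BirthDeath.semigroup Pr X) t /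
          ((t : ℝ) : EReal))
      (𝓝[>] 0)
      (𝓝 (BirthDeath.wassersteinCurvature (BirthDeath.weightDist u)
        (BirthDeath.semigroup Pr X))) ∧
    BirthDeath.wassersteinCurvature (BirthDeath.weightDist u) (BirthDeath.semigroup Pr X) =
      ⨅ x : ℕ, ((nu (x + 1) + lam x - nu x * (BirthDeath.prevWeight u x / u x)
        - lam (x + 1) * (u (x + 1) / u x) : ℝ) : EReal) := by

  set P := BirthDeath.curvatureProfile (BirthDeath.weightDist u) (BirthDeath.semigroup Pr X)
  change Tendsto (fun t : ℝ≥0 => P t / ((t : ℝ) : EReal)) (𝓝[>] 0)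
      (𝓝 (⨅ (t : ℝ≥0) (_ : 0 < t), P t / ((t : ℝ) : EReal))) ∧
    ⨅ (t : ℝ≥0) (_ : 0 < t), P t / ((t : ℝ) : EReal) =
      ⨅ x : ℕ, (BirthDeath.potential lam nu u x : EReal)
  have hlow : ∀ t : ℝ≥0, 0 < t →
      ⨅ x : ℕ, (BirthDeath.potential lam nu u x : EReal) ≤ P t / ((t : ℝ) : EReal) := by
    intro t ht
    -- Inserting a real c below inf V covers the case inf V = -∞, where no such a exists.
    refine le_of_forall_lt fun a ha => ?_
    obtain ⟨c, hac, hc⟩ := EReal.lt_iff_exists_real_btwn.1 ha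
    exact hac.trans_le (hX.le_curvatureProfile_div hrates hu
      (fun x => EReal.coe_le_coe_iff.1 (hc.le.trans (iInf_le _ x))) ht fun x => hmoment t x ht)
  have hup : ∀ a > ⨅ x : ℕ, (BirthDeath.potential lam nu u x : EReal),
      ∀ᶠ t : ℝ≥0 in 𝓝[>] 0, P t / ((t : ℝ) : EReal) < a := by
    intro a ha
    obtain ⟨x, hx⟩ := iInf_lt_iff.1 ha
    obtain ⟨c, hxc, hca⟩ := EReal.lt_iff_exists_real_btwn.1 hx
    exact (hX.eventually_curvatureProfile_div_le hrates hu (EReal.coe_lt_coe_iff.1 hxc)).mono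
      fun t ht => ht.trans_lt hca
  have heq : ⨅ (t : ℝ≥0) (_ : 0 < t), P t / ((t : ℝ) : EReal) =
      ⨅ x : ℕ, (BirthDeath.potential lam nu u x : EReal) := by
    refine le_antisymm (le_of_forall_gt fun a ha => ?_) (le_iInf₂ hlow)
    obtain ⟨t, hta, ht⟩ := ((hup a ha).and self_mem_nhdsWithin).exists
    exact (iInf₂_le t ht).trans_lt hta
  refine ⟨?_, heq⟩
  rw [heq]
  exact tendsto_order.2 ⟨fun a ha => eventually_mem_nhdsWithin.mono fun t ht =>
    ha.trans_le (hlow t ht), hup⟩
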